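/- Let $(\mathscr{X}, \mathscr{A}, P)$ be a probability space and, for every $n \ge 1$, let $X_1, \ldots, X_n$ be an independent random sample from $P$, defined on a probability space with probability measure $\mathbb{P}$. For every $n$ let $d_n \ge 1$ be an integer and let $h_n = (h_{n,1}, \ldots, h_{n,d_n})^\top : \mathscr{X} \to \mathbb{R}^{d_n}$ be a measurable map whose components are square-integrable with respect to $P$ and whose Gram matrix $P(h_n h_n^\top) = \int_{\mathscr{X}} h_n(x) h_n(x)^\top \, \mathrm{d}P(x)$ is invertible. Put $$\hbar_n = P(h_n h_n^\top)^{-1/2} h_n, \qquad q_n(x) = \hbar_n(x)^\top \hbar_n(x), \qquad P_n(\hbar_n \hbar_n^\top) = \frac{1}{n} \sum_{i=1}^n \hbar_n(X_i) \hbar_n(X_i)^\top,$$ where $P(h_n h_n^\top)^{-1/2}$ is the inverse of the symmetric positive definite square root of $P(h_n h_n^\top)$. Write $P(q_n^2) = \int_{\mathscr{X}} q_n(x)^2 \, \mathrm{d}P(x)$ and $\|q_n\|_\infty = \sup_{x \in \mathscr{X}} |q_n(x)|$. Suppose that one of the following two conditions holds as $n \to \infty$: (a) $P(q_n^2) = \mathrm{o}(n)$;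 (b) $\|q_n\|_\infty \log(2 d_n) = \mathrm{o}(n)$. Then, as $n \to \infty$, the matrix $P_n(\hbar_n \hbar_n^\top)$ is invertible with probability tending to one, and its smallest eigenvalue satisfies $\lambda_{\min}\{P_n(\hbar_n \hbar_n^\top)\} \ge 1 + \mathrm{o}_{\mathbb{P}}(1)$, that is, it is at least $1 + R_n$ for random variables $R_n$ that converge to zero in probability. -/

import Mathlib

open MeasureTheory ProbabilityTheory Filter Topology
open scoped ENNReal Matrix MatrixOrder

noncomputable section

namespace WhitenedGram

variable {𝒳 : Type*} {d : ℕ}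

/-- The Gram matrix `P(h hᵀ)` of a feature map `h` under `P`. -/
def gram [MeasurableSpace 𝒳] (P : Measure 𝒳) (h : 𝒳 → Fin d → ℝ) : Matrix (Fin d) (Fin d) ℝ :=
  Matrix.of fun i j => ∫ x, h x i * h x j ∂P

/-- The whitened feature map `ħ = P(h hᵀ)^{-1/2} h`, where `P(h hᵀ)^{-1/2}` is the inverse of the
positive semidefinite square root of the Gram matrix. -/
def whiten [MeasurableSpace 𝒳] (P : Measure 𝒳) (h : 𝒳 → Fin d → ℝ) : 𝒳 → Fin d → ℝ :=
  fun x => (CFC.sqrt (gram P h))⁻¹ *ᵥ h x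

/-- The leverage function `q(x) = ħ(x)ᵀ ħ(x)`. -/
def leverage [MeasurableSpace 𝒳] (P : Measure 𝒳) (h : 𝒳 → Fin d → ℝ) : 𝒳 → ℝ :=
  fun x => whiten P h x ⬝ᵥ whiten P h x

/-- The supremum norm `sup_x |q(x)|`, with value `∞` for an unbounded function. -/
def supNorm (q : 𝒳 → ℝ) : ℝ≥0∞ := ⨆ x, ENNReal.ofReal |q x|

/-- The empirical Gram matrix `P_n(g gᵀ) = n⁻¹ ∑ g(x_i) g(x_i)ᵀ` of a map `g` on a sample
`x_1, …, x_n`. -/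
def empGram {n : ℕ} (x : Fin n → 𝒳) (g : 𝒳 → Fin d → ℝ) : Matrix (Fin d) (Fin d) ℝ :=
  (n : ℝ)⁻¹ • ∑ i, Matrix.vecMulVec (g (x i)) (g (x i))

/-- The smallest eigenvalue of a real symmetric matrix of size `d ≥ 1`, as the infimum of its
(finite, nonempty) spectrum. -/
def lambdaMin (A : Matrix (Fin d) (Fin d) ℝ) : ℝ := sInf (spectrum ℝ A)

end WhitenedGram

end

/-! The vectors `V_i = ħ_n(X_i)` are i.i.d. and isotropic: their second-moment matrix is the
identity. Everything follows from `μ(λ_min < 1 - ε) → 0` for each `ε ∈ (0, 1]`; invertibility is the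
case `ε = 1/2`, and `R_n = min (λ_min - 1) 0`.

Under (a), a smallest eigenvalue below `1 - ε` forces the Frobenius distance of the empirical matrix
from the identity to be at least `ε`. Independence bounds its mean square by `P(q_n²) / n`, and
Markov's inequality concludes (`measureReal_lambdaMin_lt_le`).

Under (b), the potential `tr (S + t)⁻ᵖ` takes the place of a matrix exponential. Adding `v vᵀ` with
`|v|² ≤ L` lowers it by at least `p (1 - pL/t) vᵀ (A + t)⁻⁽ᵖ⁺¹⁾ v`
(`resolventMoment_add_vecMulVec_le`). Averaging over isotropic `v` turns the quadratic form into a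
trace, and convexity of `x⁻ᵖ` then shows that one random vector costs no more, in mean, than raising
`t` to `t + r`, if `r ≤ 1 - pL/t`. Starting from `S = 0`, `t = n`, the sum of `n` vectors satisfies
`E tr (S + n)⁻ᵖ ≤ d (n + nr)⁻ᵖ`. One eigenvalue of `S` below `n (1 - ε)` already contributes `(n (2
- ε))⁻ᵖ`, so Markov's inequality with `r = 1 - ε/2` gives the tail bound `d (1 - ε/4)ᵖ`
(`measure_lambdaMin_lt_le`). A `p` of order `log (2d)` makes it small, and `L log (2d) = o(n)`
leaves room for such a `p`. -/

namespace WhitenedGram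

/-! ### Resolvent traces and their rank-one updates. -/

variable {d : ℕ}

/-- The trace of the `p`-th power of the resolvent `(A + t)⁻¹`. -/
noncomputable def resolventMoment (p : ℕ) (t : ℝ) (A : Matrix (Fin d) (Fin d) ℝ) : ℝ :=
  (((A + t • (1 : Matrix (Fin d) (Fin d) ℝ))⁻¹) ^ p).trace

theorem exists_orthogonal_diagonalization {A : Matrix (Fin d) (Fin d) ℝ} (hA : A.IsHermitian) :
    ∃ U : Matrix (Fin d) (Fin d) ℝ, U * Uᵀ = 1 ∧ Uᵀ * U = 1 ∧
      A = U * Matrix.diagonal hA.eigenvalues * Uᵀ := by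
  refine ⟨hA.eigenvectorUnitary, ?_, ?_, ?_⟩
  · exact Unitary.coe_mul_star_self hA.eigenvectorUnitary
  · exact Unitary.coe_star_mul_self hA.eigenvectorUnitary
  · exact hA.spectral_theorem

theorem resolvent_pow_of_diagonalization {A U : Matrix (Fin d) (Fin d) ℝ} {a : Fin d → ℝ}
    (h₁ : U * Uᵀ = 1) (h₂ : Uᵀ * U = 1) (hA : A = U * Matrix.diagonal a * Uᵀ) {t : ℝ}
    (ht : ∀ i, a i + t ≠ 0) (k : ℕ) :
    ((A + t • (1 : Matrix (Fin d) (Fin d) ℝ))⁻¹) ^ k =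
      U * Matrix.diagonal (fun i => ((a i + t)⁻¹) ^ k) * Uᵀ := by
  have h1 : A + t • (1 : Matrix (Fin d) (Fin d) ℝ) =
      U * Matrix.diagonal (fun i => a i + t) * Uᵀ := by
    have : Matrix.diagonal (fun i => a i + t) =
        Matrix.diagonal a + t • (1 : Matrix (Fin d) (Fin d) ℝ) := by
      ext i j
      by_cases h : i = j
      · subst h; simp
      · simp [h]
    rw [this, mul_add, add_mul, ← hA, mul_smul_comm, mul_one, smul_mul_assoc, h₁]
  have h2 : (A + t • (1 : Matrix (Fin d) (Fin d) ℝ))⁻¹ =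
      U * Matrix.diagonal (fun i => (a i + t)⁻¹) * Uᵀ := by
    apply Matrix.inv_eq_right_inv
    rw [h1]
    calc U * Matrix.diagonal (fun i => a i + t) * Uᵀ *
          (U * Matrix.diagonal (fun i => (a i + t)⁻¹) * Uᵀ)
        = U * (Matrix.diagonal (fun i => a i + t) * (Uᵀ * U) *
            Matrix.diagonal (fun i => (a i + t)⁻¹)) * Uᵀ := by simp only [mul_assoc]
      _ = 1 := by
          rw [h₂, mul_one, Matrix.diagonal_mul_diagonal]
          simp [ht, h₁]
  rw [h2]
  induction k with
  | zero => simp [h₁]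
  | succ k ih =>
    rw [pow_succ, ih]
    calc U * Matrix.diagonal (fun i => (a i + t)⁻¹ ^ k) * Uᵀ *
          (U * Matrix.diagonal (fun i => (a i + t)⁻¹) * Uᵀ)
        = U * (Matrix.diagonal (fun i => (a i + t)⁻¹ ^ k) * (Uᵀ * U) *
            Matrix.diagonal (fun i => (a i + t)⁻¹)) * Uᵀ := by simp only [mul_assoc]
      _ = _ := by
          rw [h₂, mul_one, Matrix.diagonal_mul_diagonal]
          simp [pow_succ]

theorem trace_conj_diagonal {U : Matrix (Fin d) (Fin d) ℝ} (h₂ : Uᵀ * U = 1) (a : Fin d → ℝ) :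
    (U * Matrix.diagonal a * Uᵀ).trace = ∑ i, a i := by
  rw [Matrix.trace_mul_comm, ← mul_assoc, h₂, one_mul, Matrix.trace_diagonal]

theorem dotProduct_conj_diagonal (U : Matrix (Fin d) (Fin d) ℝ) (a v : Fin d → ℝ) :
    v ⬝ᵥ (U * Matrix.diagonal a * Uᵀ) *ᵥ v = ∑ i, a i * (Uᵀ *ᵥ v) i ^ 2 := by
  rw [← Matrix.mulVec_mulVec, ← Matrix.mulVec_mulVec, Matrix.dotProduct_mulVec,
    ← Matrix.mulVec_transpose]
  simp only [dotProduct, Matrix.mulVec_diagonal]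
  exact Finset.sum_congr rfl fun i _ => by ring

theorem sum_sq_transpose_mulVec {U : Matrix (Fin d) (Fin d) ℝ} (h₁ : U * Uᵀ = 1)
    (v : Fin d → ℝ) : ∑ i, (Uᵀ *ᵥ v) i ^ 2 = v ⬝ᵥ v := by
  have := dotProduct_conj_diagonal U 1 v
  rw [Matrix.diagonal_one', mul_one, h₁, Matrix.one_mulVec] at this
  simpa using this.symm

theorem resolventMoment_eq_sum {A : Matrix (Fin d) (Fin d) ℝ} (hA : A.PosSemidef) {t : ℝ}
    (ht : 0 < t) (p : ℕ) :
    resolventMoment p t A = ∑ i, ((hA.isHermitian.eigenvalues i + t)⁻¹) ^ p := by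
  obtain ⟨U, h₁, h₂, h⟩ := exists_orthogonal_diagonalization hA.isHermitian
  rw [resolventMoment, resolvent_pow_of_diagonalization h₁ h₂ h
    (fun i => (add_pos_of_nonneg_of_pos (hA.eigenvalues_nonneg i) ht).ne'),
    trace_conj_diagonal h₂]

theorem resolventMoment_nonneg {A : Matrix (Fin d) (Fin d) ℝ} (hA : A.PosSemidef) {t : ℝ}
    (ht : 0 < t) (p : ℕ) : 0 ≤ resolventMoment p t A := by
  rw [resolventMoment_eq_sum hA ht]
  exact Finset.sum_nonneg fun i _ =>
    pow_nonneg (inv_nonneg.2 (add_nonneg (hA.eigenvalues_nonneg i) ht.le)) _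

/-- The convex function `x⁻ᵖ` lies above its tangent; this is Bernoulli's inequality for `x / (x +
r)`. -/
theorem pow_inv_sub_le_pow_inv_add {x r : ℝ} (hx : 0 < x) (hr : 0 ≤ r) (p : ℕ) :
    (x⁻¹) ^ p - p * r * (x⁻¹) ^ (p + 1) ≤ ((x + r)⁻¹) ^ p := by
  have h1 : 1 - r * x⁻¹ ≤ x / (x + r) := by
    rw [le_div_iff₀ (by positivity)]
    have : x⁻¹ * x = 1 := inv_mul_cancel₀ hx.ne'
    nlinarith [mul_nonneg (mul_nonneg hr hr) (inv_nonneg.2 hx.le)]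
  have h0 : 0 ≤ x / (x + r) := by positivity
  have h2 : 1 + (p : ℝ) * (x / (x + r) - 1) ≤ (1 + (x / (x + r) - 1)) ^ p :=
    one_add_mul_le_pow (by linarith) p
  rw [add_sub_cancel] at h2
  have h3 : 1 - p * r * x⁻¹ ≤ (x / (x + r)) ^ p := by
    refine le_trans ?_ h2
    nlinarith [mul_le_mul_of_nonneg_left h1 (Nat.cast_nonneg (α := ℝ) p)]
  calc (x⁻¹) ^ p - p * r * (x⁻¹) ^ (p + 1) = (x⁻¹) ^ p * (1 - p * r * x⁻¹) := by ring
    _ ≤ (x⁻¹) ^ p * (x / (x + r)) ^ p := by gcongr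
    _ = _ := by rw [← mul_pow]; congr 1; field_simp

/-- Convexity of `x ↦ x⁻ᵖ` lifted to the trace of the resolvent. -/
theorem resolventMoment_sub_le {A : Matrix (Fin d) (Fin d) ℝ} (hA : A.PosSemidef) {t r : ℝ}
    (ht : 0 < t) (hr : 0 ≤ r) (p : ℕ) :
    resolventMoment p t A - p * r * resolventMoment (p + 1) t A ≤ resolventMoment p (t + r) A := by
  rw [resolventMoment_eq_sum hA ht, resolventMoment_eq_sum hA ht,
    resolventMoment_eq_sum hA (by positivity : 0 < t + r), Finset.mul_sum,
    ← Finset.sum_sub_distrib]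
  refine Finset.sum_le_sum fun i _ => ?_
  rw [← add_assoc]
  exact pow_inv_sub_le_pow_inv_add (add_pos_of_nonneg_of_pos (hA.eigenvalues_nonneg i) ht) hr p

theorem resolvent_posSemidef {A : Matrix (Fin d) (Fin d) ℝ} (hA : A.PosSemidef) {t : ℝ}
    (ht : 0 < t) : ((A + t • (1 : Matrix (Fin d) (Fin d) ℝ))⁻¹).PosSemidef :=
  (hA.add (Matrix.PosSemidef.one.smul ht.le)).inv

theorem isUnit_add_smul_one {A : Matrix (Fin d) (Fin d) ℝ} (hA : A.PosSemidef) {t : ℝ}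
    (ht : 0 < t) : IsUnit (A + t • (1 : Matrix (Fin d) (Fin d) ℝ)).det :=
  (Matrix.isUnit_iff_isUnit_det _).1
    ((Matrix.PosDef.posSemidef_add hA (Matrix.PosDef.one.smul ht)).isUnit)

theorem dotProduct_resolvent_le {A : Matrix (Fin d) (Fin d) ℝ} (hA : A.PosSemidef) {t : ℝ}
    (ht : 0 < t) (v : Fin d → ℝ) :
    v ⬝ᵥ (A + t • (1 : Matrix (Fin d) (Fin d) ℝ))⁻¹ *ᵥ v ≤ t⁻¹ * (v ⬝ᵥ v) := by
  obtain ⟨U, h₁, h₂, h⟩ := exists_orthogonal_diagonalization hA.isHermitian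
  have := resolvent_pow_of_diagonalization h₁ h₂ h (t := t)
    (fun i => (add_pos_of_nonneg_of_pos (hA.eigenvalues_nonneg i) ht).ne') 1
  rw [pow_one] at this
  rw [this, dotProduct_conj_diagonal, ← sum_sq_transpose_mulVec h₁, Finset.mul_sum]
  refine Finset.sum_le_sum fun i _ => mul_le_mul_of_nonneg_right ?_ (sq_nonneg _)
  rw [pow_one]
  exact inv_anti₀ ht (by linarith [hA.eigenvalues_nonneg i])

/-- The two sides differ by `x y (xᵃ - yᵃ)(xᵇ - yᵇ)`, whose last two factors never have opposite
signs. -/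
theorem mul_pow_add_mul_pow_le {x y : ℝ} (hx : 0 ≤ x) (hy : 0 ≤ y) (a b : ℕ) :
    x ^ (a + 1) * y ^ (b + 1) + y ^ (a + 1) * x ^ (b + 1) ≤
      x * y ^ (a + b + 1) + y * x ^ (a + b + 1) := by
  have h : 0 ≤ x * y * ((x ^ a - y ^ a) * (x ^ b - y ^ b)) := by
    refine mul_nonneg (mul_nonneg hx hy) ?_
    rcases le_total x y with h | h
    · exact mul_nonneg_of_nonpos_of_nonpos (sub_nonpos.2 (pow_le_pow_left₀ hx h _))
        (sub_nonpos.2 (pow_le_pow_left₀ hx h _))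
    · exact mul_nonneg (sub_nonneg.2 (pow_le_pow_left₀ hy h _))
        (sub_nonneg.2 (pow_le_pow_left₀ hy h _))
  have e : x * y ^ (a + b + 1) + y * x ^ (a + b + 1) -
      (x ^ (a + 1) * y ^ (b + 1) + y ^ (a + 1) * x ^ (b + 1)) =
      x * y * ((x ^ a - y ^ a) * (x ^ b - y ^ b)) := by ring
  linarith

/-- Chebyshev's sum inequality for the moments of a nonnegative weight. -/
theorem moment_mul_moment_le {ι : Type*} (s : Finset ι) (x w : ι → ℝ) (hx : ∀ i, 0 ≤ x i)
    (hw : ∀ i, 0 ≤ w i) (a b : ℕ) :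
    (∑ i ∈ s, x i ^ (a + 1) * w i) * (∑ i ∈ s, x i ^ (b + 1) * w i) ≤
      (∑ i ∈ s, x i * w i) * (∑ i ∈ s, x i ^ (a + b + 1) * w i) := by
  -- Symmetrized over pairs `(i, j)`, each side is twice a product of sums, so the two-point
  -- inequality suffices.
  have key : ∑ i ∈ s, ∑ j ∈ s, w i * w j *
        (x i ^ (a + 1) * x j ^ (b + 1) + x j ^ (a + 1) * x i ^ (b + 1)) ≤
      ∑ i ∈ s, ∑ j ∈ s, w i * w j * (x i * x j ^ (a + b + 1) + x j * x i ^ (a + b + 1)) :=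
    Finset.sum_le_sum fun i _ => Finset.sum_le_sum fun j _ =>
      mul_le_mul_of_nonneg_left (mul_pow_add_mul_pow_le (hx i) (hx j) a b)
        (mul_nonneg (hw i) (hw j))
  have expand : ∀ f g : ι → ℝ, ∑ i ∈ s, ∑ j ∈ s, w i * w j * (f i * g j + f j * g i) =
      2 * ((∑ i ∈ s, f i * w i) * (∑ i ∈ s, g i * w i)) := by
    intro f g
    have : ∀ f g : ι → ℝ, ∑ i ∈ s, ∑ j ∈ s, w i * w j * (f i * g j) =
        (∑ i ∈ s, f i * w i) * (∑ i ∈ s, g i * w i) := by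
      intro f g
      rw [Finset.sum_mul_sum]
      exact Finset.sum_congr rfl fun i _ => Finset.sum_congr rfl fun j _ => by ring
    simp only [mul_add, Finset.sum_add_distrib, mul_comm (f _) (g _)]
    rw [this, two_mul, ← this g f, ← this f g]
    congr 1
    simp only [mul_comm (f _) (g _)]
    rw [this, mul_comm, ← this]
  rw [expand (fun i => x i ^ (a + 1)) (fun i => x i ^ (b + 1)),
    expand x (fun i => x i ^ (a + b + 1))] at key
  linarith

/-- In an eigenbasis, each form is a moment of the inverse shifted eigenvalues, weighted by the
squared coordinates of `v`, and Chebyshev's sum inequality applies. -/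
theorem resolvent_moment_mul_le {A : Matrix (Fin d) (Fin d) ℝ} (hA : A.PosSemidef) {t : ℝ}
    (ht : 0 < t) (v : Fin d → ℝ) {D : Matrix (Fin d) (Fin d) ℝ}
    (hD : D = (A + t • (1 : Matrix (Fin d) (Fin d) ℝ))⁻¹) (a b : ℕ) :
    (v ⬝ᵥ (D ^ (a + 1)) *ᵥ v) * (v ⬝ᵥ (D ^ (b + 1)) *ᵥ v) ≤
      (v ⬝ᵥ D *ᵥ v) * (v ⬝ᵥ (D ^ (a + b + 1)) *ᵥ v) := by
  obtain ⟨U, h₁, h₂, h⟩ := exists_orthogonal_diagonalization hA.isHermitian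
  have hpos i := add_pos_of_nonneg_of_pos (hA.eigenvalues_nonneg i) ht
  have hk := fun k => resolvent_pow_of_diagonalization h₁ h₂ h (t := t) (fun i => (hpos i).ne') k
  have hk1 := hk 1
  rw [← hD] at hk1
  simp only [← hD] at hk
  rw [pow_one] at hk1
  rw [hk (a + 1), hk (b + 1), hk (a + b + 1), hk1]
  simp only [dotProduct_conj_diagonal, pow_one]
  exact moment_mul_moment_le _ _ (fun i => (Uᵀ *ᵥ v) i ^ 2) (fun i => inv_nonneg.2 (hpos i).le)
    (fun i => sq_nonneg _) a b

theorem dotProduct_pow_nonneg {D : Matrix (Fin d) (Fin d) ℝ} (hD : D.PosSemidef) (k : ℕ)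
    (v : Fin d → ℝ) : 0 ≤ v ⬝ᵥ (D ^ k) *ᵥ v := by
  simpa using (hD.pow k).dotProduct_mulVec_nonneg v

theorem dotProduct_mul_vecMulVec_mul (M N : Matrix (Fin d) (Fin d) ℝ) (v : Fin d → ℝ) :
    v ⬝ᵥ (M * Matrix.vecMulVec v v * N) *ᵥ v = (v ⬝ᵥ M *ᵥ v) * (v ⬝ᵥ N *ᵥ v) := by
  rw [← Matrix.mulVec_mulVec, ← Matrix.mulVec_mulVec, Matrix.vecMulVec_mulVec]
  simp [Matrix.mulVec_smul, mul_comm]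

theorem vecMulVec_self_posSemidef (v : Fin d → ℝ) : (Matrix.vecMulVec v v).PosSemidef := by
  simpa using Matrix.posSemidef_vecMulVec_self_star v

/-- Effect of a rank-one update on the trace of a power of the resolvent. -/
theorem resolventMoment_add_vecMulVec_le {A : Matrix (Fin d) (Fin d) ℝ} (hA : A.PosSemidef)
    {t L : ℝ} (ht : 0 < t) {v : Fin d → ℝ} (hv : v ⬝ᵥ v ≤ L) (p : ℕ) :
    resolventMoment p t (A + Matrix.vecMulVec v v) ≤ resolventMoment p t A -
      p * (1 - p * L / t) *
        (v ⬝ᵥ (((A + t • (1 : Matrix (Fin d) (Fin d) ℝ))⁻¹) ^ (p + 1)) *ᵥ v) := by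
  have hA' : (A + Matrix.vecMulVec v v).PosSemidef := hA.add (vecMulVec_self_posSemidef v)
  unfold resolventMoment
  have huB := isUnit_add_smul_one hA ht
  have huB' := isUnit_add_smul_one hA' ht
  have hDp := resolvent_posSemidef hA ht
  have hDp' := resolvent_posSemidef hA' ht
  have hs1 := dotProduct_resolvent_le hA ht v
  have hcheb := fun a b => resolvent_moment_mul_le hA ht v rfl a b
  set D := (A + t • (1 : Matrix (Fin d) (Fin d) ℝ))⁻¹ with hD
  set D' := (A + Matrix.vecMulVec v v + t • (1 : Matrix (Fin d) (Fin d) ℝ))⁻¹ with hD'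
  -- Resolvent identity. It drives the telescoping from `D ^ p` to `D' ^ p`, which exchanges one
  -- factor at a time.
  have hdiff : D - D' = D * Matrix.vecMulVec v v * D' := by
    have e : Matrix.vecMulVec v v = (A + Matrix.vecMulVec v v +
        t • (1 : Matrix (Fin d) (Fin d) ℝ)) - (A + t • (1 : Matrix (Fin d) (Fin d) ℝ)) := by abel
    rw [e, mul_sub, sub_mul, mul_assoc, hD', Matrix.mul_nonsing_inv _ huB', mul_one, hD,
      Matrix.nonsing_inv_mul _ huB, one_mul]
  have hstep : ∀ a b : ℕ, D ^ (a + 1) * D' ^ b - D ^ a * D' ^ (b + 1) =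
      D ^ (a + 1) * Matrix.vecMulVec v v * D' ^ (b + 1) := by
    intro a b
    calc D ^ (a + 1) * D' ^ b - D ^ a * D' ^ (b + 1) = D ^ a * (D - D') * D' ^ b := by
          rw [pow_succ D, pow_succ' D']; noncomm_ring
      _ = _ := by rw [hdiff, pow_succ D, pow_succ' D']; simp only [mul_assoc]
  have hrec : ∀ a b : ℕ, v ⬝ᵥ (D ^ (a + 1) * D' ^ b) *ᵥ v - v ⬝ᵥ (D ^ a * D' ^ (b + 1)) *ᵥ v =
      (v ⬝ᵥ (D ^ (a + 1)) *ᵥ v) * (v ⬝ᵥ (D' ^ (b + 1)) *ᵥ v) := by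
    intro a b
    rw [← dotProduct_mul_vecMulVec_mul, ← hstep, Matrix.sub_mulVec, dotProduct_sub]
  have hm0 := fun k => dotProduct_pow_nonneg hDp k v
  have hm0' := fun k => dotProduct_pow_nonneg hDp' k v
  have hmono : ∀ b a : ℕ, v ⬝ᵥ (D ^ a * D' ^ b) *ᵥ v ≤ v ⬝ᵥ (D ^ (a + b)) *ᵥ v := by
    intro b
    induction b with
    | zero => intro a; simp
    | succ b ih =>
      intro a
      have := ih (a + 1)
      have h := hrec a b
      have := mul_nonneg (hm0 (a + 1)) (hm0' (b + 1))
      rw [show a + (b + 1) = a + 1 + b by ring]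
      linarith
  have hmle : ∀ b, v ⬝ᵥ (D' ^ b) *ᵥ v ≤ v ⬝ᵥ (D ^ b) *ᵥ v := by
    intro b; simpa using hmono b 0
  -- Each exchange of a `D` for a `D'` loses a product of two moments, at most `vᵀDv` times the full
  -- moment by `hmle` and `hcheb`.
  have hlow : ∀ b a : ℕ, (1 - b * (v ⬝ᵥ D *ᵥ v)) * (v ⬝ᵥ (D ^ (a + b)) *ᵥ v) ≤
      v ⬝ᵥ (D ^ a * D' ^ b) *ᵥ v := by
    intro b
    induction b with
    | zero => intro a; simp
    | succ b ih =>
      intro a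
      have h1 := ih (a + 1)
      have h2 := hrec a b
      have h3 := mul_le_mul_of_nonneg_left (hmle (b + 1)) (hm0 (a + 1))
      have h4 := hcheb a b
      rw [show a + 1 + b = a + b + 1 by ring] at h1
      rw [show a + (b + 1) = a + b + 1 by ring]
      push_cast
      linarith
  have hs : v ⬝ᵥ D *ᵥ v ≤ L / t := by
    rw [div_eq_inv_mul]
    exact hs1.trans (mul_le_mul_of_nonneg_left hv (inv_nonneg.2 ht.le))
  have hs0 : 0 ≤ v ⬝ᵥ D *ᵥ v := by simpa using hm0 1
  have hsymm : ∀ a b : ℕ, v ⬝ᵥ (D' ^ b * D ^ a) *ᵥ v = v ⬝ᵥ (D ^ a * D' ^ b) *ᵥ v := by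
    intro a b
    have e : (D ^ a * D' ^ b)ᵀ = D' ^ b * D ^ a := by
      rw [Matrix.transpose_mul, Matrix.transpose_pow, Matrix.transpose_pow,
        show Dᵀ = D from hDp.isHermitian,
        show D'ᵀ = D' from hDp'.isHermitian]
    rw [← e, Matrix.mulVec_transpose, dotProduct_comm, ← Matrix.dotProduct_mulVec]
  have htr : ∀ a b : ℕ, (1 - (b + 1 : ℕ) * (v ⬝ᵥ D *ᵥ v)) * (v ⬝ᵥ (D ^ (a + b + 2)) *ᵥ v) ≤
      (D ^ (a + 1) * D' ^ b).trace - (D ^ a * D' ^ (b + 1)).trace := by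
    intro a b
    rw [← Matrix.trace_sub, hstep, mul_assoc, Matrix.trace_mul_comm, mul_assoc,
      Matrix.vecMulVec_mul, Matrix.trace_vecMulVec, dotProduct_comm v (v ᵥ* _), ← Matrix.dotProduct_mulVec,
      hsymm]
    have := hlow (b + 1) (a + 1)
    rwa [show a + 1 + (b + 1) = a + b + 2 by ring] at this
  -- Since `b + 1 ≤ p` and `vᵀDv ≤ L / t`, every telescoping term has the common lower factor `1 -
  -- pL/t`.
  have hsum : ∀ b a : ℕ, a + b = p →
      b * ((1 - p * L / t) * (v ⬝ᵥ (D ^ (p + 1)) *ᵥ v)) ≤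
        (D ^ p).trace - (D ^ a * D' ^ b).trace := by
    intro b
    induction b with
    | zero => intro a ha; simp at ha; simp [ha]
    | succ b ih =>
      intro a ha
      have h1 := ih (a + 1) (by omega)
      have h2 := htr a b
      rw [show a + b + 2 = p + 1 by omega] at h2
      have hb : ((b + 1 : ℕ) : ℝ) ≤ p := by exact_mod_cast (by omega : b + 1 ≤ p)
      have h3 : 1 - p * L / t ≤ 1 - (b + 1 : ℕ) * (v ⬝ᵥ D *ᵥ v) := by
        have : ((b + 1 : ℕ) : ℝ) * (v ⬝ᵥ D *ᵥ v) ≤ p * (L / t) :=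
          mul_le_mul hb hs hs0 (Nat.cast_nonneg _)
        rw [mul_div_assoc]; linarith
      have h4 := mul_le_mul_of_nonneg_right h3 (hm0 (p + 1))
      push_cast at h2 h4 ⊢
      linarith
  have := hsum p 0 (by simp)
  rw [pow_zero, one_mul] at this
  linarith

end WhitenedGram

/-! ### Smallest eigenvalue, and the tail bound for bounded isotropic vectors. -/

namespace WhitenedGram

variable {d : ℕ}

theorem le_lambdaMin_iff (hd : 1 ≤ d) {A : Matrix (Fin d) (Fin d) ℝ} (hA : A.IsHermitian) (b : ℝ) :
    b ≤ lambdaMin A ↔ ∀ i, b ≤ hA.eigenvalues i := by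
  have : Nonempty (Fin d) := ⟨⟨0, hd⟩⟩
  rw [lambdaMin, hA.spectrum_real_eq_range_eigenvalues,
    le_csInf_iff (Set.finite_range _).bddBelow (Set.range_nonempty _), Set.forall_mem_range]

/-- Variational form of the smallest eigenvalue. The size must be positive because `sInf ∅ = 0`. -/
theorem le_lambdaMin_iff_forall_dotProduct (hd : 1 ≤ d) {A : Matrix (Fin d) (Fin d) ℝ}
    (hA : A.IsHermitian) (b : ℝ) :
    b ≤ lambdaMin A ↔ ∀ x, b * (x ⬝ᵥ x) ≤ x ⬝ᵥ A *ᵥ x := by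
  rw [le_lambdaMin_iff hd hA]
  obtain ⟨U, h₁, h₂, h⟩ := exists_orthogonal_diagonalization hA
  constructor
  · intro hb x
    conv_rhs => rw [h]
    rw [dotProduct_conj_diagonal, ← sum_sq_transpose_mulVec h₁, Finset.mul_sum]
    exact Finset.sum_le_sum fun i _ => mul_le_mul_of_nonneg_right (hb i) (sq_nonneg _)
  · intro hb i
    have hx := hb (U *ᵥ Pi.single i 1)
    have e : Uᵀ *ᵥ (U *ᵥ Pi.single i 1) = Pi.single i 1 := by
      rw [Matrix.mulVec_mulVec, h₂, Matrix.one_mulVec]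
    conv_rhs at hx => rw [h]
    rw [dotProduct_conj_diagonal, ← sum_sq_transpose_mulVec h₁, e] at hx
    simpa [Pi.single_apply] using hx

theorem isUnit_of_lambdaMin_pos {A : Matrix (Fin d) (Fin d) ℝ} (hA : A.IsHermitian)
    (h : 0 < lambdaMin A) : IsUnit A := by
  rw [← spectrum.zero_notMem_iff ℝ]
  intro h0
  have : lambdaMin A ≤ 0 := csInf_le
    (by rw [hA.spectrum_real_eq_range_eigenvalues]; exact (Set.finite_range _).bddBelow) h0
  linarith

theorem sum_vecMulVec_posSemidef {ι : Type*} (s : Finset ι) (x : ι → Fin d → ℝ) :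
    (∑ i ∈ s, Matrix.vecMulVec (x i) (x i)).PosSemidef :=
  Matrix.posSemidef_sum s fun i _ => vecMulVec_self_posSemidef (x i)

/-- Supplies the measurability needed for Tonelli's theorem and Markov's inequality. -/
theorem continuous_resolventMoment_sum {A : Matrix (Fin d) (Fin d) ℝ} (hA : A.PosSemidef) {t : ℝ}
    (ht : 0 < t) (p n : ℕ) :
    Continuous fun x : Fin n → Fin d → ℝ =>
      resolventMoment p t (A + ∑ i, Matrix.vecMulVec (x i) (x i)) := by
  unfold resolventMoment
  simp only [Matrix.inv_def, Ring.inverse_eq_inv']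
  have hc : Continuous fun x : Fin n → Fin d → ℝ => A + ∑ i, Matrix.vecMulVec (x i) (x i) +
      t • (1 : Matrix (Fin d) (Fin d) ℝ) := by
    refine (continuous_const.add (continuous_finsetSum _ fun i _ => ?_)).add continuous_const
    exact Continuous.matrix_vecMulVec (continuous_apply i) (continuous_apply i)
  refine Continuous.matrix_trace (((hc.matrix_det.inv₀ fun x => ?_).smul hc.matrix_adjugate).pow p)
  exact (isUnit_add_smul_one (hA.add (sum_vecMulVec_posSemidef _ x)) ht).ne_zero

/-- A measure on `ℝᵈ` with second-moment matrix equal to the identity. -/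
structure IsIsotropic (ν : Measure (Fin d → ℝ)) : Prop where
  integrable_mul : ∀ i j, Integrable (fun v => v i * v j) ν
  integral_mul : ∀ i j, ∫ v, v i * v j ∂ν = (1 : Matrix (Fin d) (Fin d) ℝ) i j

theorem dotProduct_mulVec_eq_sum (M : Matrix (Fin d) (Fin d) ℝ) (v : Fin d → ℝ) :
    v ⬝ᵥ M *ᵥ v = ∑ i, ∑ j, M i j * (v i * v j) := by
  simp only [dotProduct, Matrix.mulVec, Finset.mul_sum]
  exact Finset.sum_congr rfl fun i _ => Finset.sum_congr rfl fun j _ => by ring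

theorem IsIsotropic.integrable_dotProduct_mulVec {ν : Measure (Fin d → ℝ)} (hν : IsIsotropic ν)
    (M : Matrix (Fin d) (Fin d) ℝ) : Integrable (fun v => v ⬝ᵥ M *ᵥ v) ν := by
  simp only [dotProduct_mulVec_eq_sum]
  exact integrable_finsetSum _ fun i _ => integrable_finsetSum _ fun j _ =>
    (hν.integrable_mul i j).const_mul _

theorem IsIsotropic.integral_dotProduct_mulVec {ν : Measure (Fin d → ℝ)} (hν : IsIsotropic ν)
    (M : Matrix (Fin d) (Fin d) ℝ) : ∫ v, v ⬝ᵥ M *ᵥ v ∂ν = M.trace := by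
  simp only [dotProduct_mulVec_eq_sum]
  refine (integral_finsetSum _ fun i _ => integrable_finsetSum _ fun j _ =>
    (hν.integrable_mul i j).const_mul _).trans (Finset.sum_congr rfl fun i _ => ?_)
  refine (integral_finsetSum _ fun j _ => (hν.integrable_mul i j).const_mul _).trans ?_
  simp only [integral_const_mul, hν.integral_mul]
  simp [Matrix.one_apply]

/-- One random isotropic summand is replaced, in mean, by a deterministic shift of `t` by `r`. -/
theorem lintegral_resolventMoment_add_vecMulVec_le {ν : Measure (Fin d → ℝ)}
    [IsProbabilityMeasure ν] (hν : IsIsotropic ν) {L : ℝ} (hL : ∀ᵐ v ∂ν, v ⬝ᵥ v ≤ L) (hL0 : 0 ≤ L)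
    {A : Matrix (Fin d) (Fin d) ℝ} (hA : A.PosSemidef) {t₀ t r : ℝ} (ht₀ : 0 < t₀) (ht : t₀ ≤ t)
    (hr : 0 ≤ r) {p : ℕ} (hp : p * L / t₀ ≤ 1 - r) :
    ∫⁻ v, ENNReal.ofReal (resolventMoment p t (A + Matrix.vecMulVec v v)) ∂ν ≤
      ENNReal.ofReal (resolventMoment p (t + r) A) := by
  have ht' : 0 < t := ht₀.trans_le ht
  set D := (A + t • (1 : Matrix (Fin d) (Fin d) ℝ))⁻¹ with hD
  have hDp : D.PosSemidef := resolvent_posSemidef hA ht'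
  have hint : Integrable (fun v => resolventMoment p t A - p * r * (v ⬝ᵥ (D ^ (p + 1)) *ᵥ v)) ν :=
    (integrable_const _).sub ((hν.integrable_dotProduct_mulVec _).const_mul _)
  have hle : ∀ᵐ v ∂ν, resolventMoment p t (A + Matrix.vecMulVec v v) ≤
      resolventMoment p t A - p * r * (v ⬝ᵥ (D ^ (p + 1)) *ᵥ v) := by
    filter_upwards [hL] with v hv
    refine (resolventMoment_add_vecMulVec_le hA ht' hv p).trans ?_
    have h1 : r ≤ 1 - p * L / t := by
      have : p * L / t ≤ p * L / t₀ := by gcongr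
      linarith
    have := mul_le_mul_of_nonneg_right (mul_le_mul_of_nonneg_left h1 (Nat.cast_nonneg (α := ℝ) p))
      (dotProduct_pow_nonneg hDp (p + 1) v)
    linarith
  -- The bound dominates a nonnegative trace, so `ENNReal.ofReal` does not truncate it.
  have hnn : 0 ≤ᵐ[ν] fun v => resolventMoment p t A - p * r * (v ⬝ᵥ (D ^ (p + 1)) *ᵥ v) := by
    filter_upwards [hle] with v hv
    exact (resolventMoment_nonneg (hA.add (vecMulVec_self_posSemidef v)) ht' p).trans hv
  calc _ ≤ ∫⁻ v, ENNReal.ofReal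
        (resolventMoment p t A - p * r * (v ⬝ᵥ (D ^ (p + 1)) *ᵥ v)) ∂ν :=
        lintegral_mono_ae (hle.mono fun v hv => ENNReal.ofReal_le_ofReal hv)
    _ = ENNReal.ofReal (resolventMoment p t A - p * r * resolventMoment (p + 1) t A) := by
        rw [← ofReal_integral_eq_lintegral_ofReal hint hnn, integral_sub (integrable_const _)
          ((hν.integrable_dotProduct_mulVec _).const_mul _), integral_const_mul,
          hν.integral_dotProduct_mulVec]
        simp [resolventMoment, hD]
    _ ≤ _ := ENNReal.ofReal_le_ofReal (resolventMoment_sub_le hA ht' hr p)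

theorem lintegral_pi_resolventMoment_le {ν : Measure (Fin d → ℝ)}
    [IsProbabilityMeasure ν] (hν : IsIsotropic ν) {L : ℝ} (hL : ∀ᵐ v ∂ν, v ⬝ᵥ v ≤ L) (hL0 : 0 ≤ L)
    {t₀ r : ℝ} (ht₀ : 0 < t₀) (hr : 0 ≤ r) {p : ℕ} (hp : p * L / t₀ ≤ 1 - r) (n : ℕ) :
    ∀ {A : Matrix (Fin d) (Fin d) ℝ}, A.PosSemidef → ∀ {t : ℝ}, t₀ ≤ t →
    ∫⁻ x, ENNReal.ofReal (resolventMoment p t (A + ∑ i, Matrix.vecMulVec (x i) (x i)))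
        ∂(Measure.pi fun _ : Fin n => ν) ≤
      ENNReal.ofReal (resolventMoment p (t + n * r) A) := by
  induction n with
  | zero =>
    intro A hA t ht
    simp
  | succ n ih =>
    intro A hA t ht
    have ht' : 0 < t := ht₀.trans_le ht
    have hmp := measurePreserving_piFinSuccAbove (fun _ : Fin (n + 1) => ν) 0
    have hmeas := (continuous_resolventMoment_sum hA ht' p (n + 1)).measurable.ennreal_ofReal
    rw [← hmp.symm.lintegral_comp hmeas]
    refine (lintegral_prod _ (hmeas.comp (MeasurableEquiv.piFinSuccAbove
      (fun _ : Fin (n + 1) => Fin d → ℝ) 0).symm.measurable).aemeasurable).trans_le ?_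
    -- The first vector is absorbed into `A`; the other `n` raise `t` by `n r`, and the one-step
    -- bound is then used at `t + n r ≥ t₀`.
    calc _ = ∫⁻ v, ∫⁻ x, ENNReal.ofReal (resolventMoment p t
            (A + Matrix.vecMulVec v v + ∑ i, Matrix.vecMulVec (x i) (x i)))
            ∂(Measure.pi fun _ : Fin n => ν) ∂ν := by
          refine lintegral_congr fun v => lintegral_congr fun x => ?_
          simp [Fin.sum_univ_succ, MeasurableEquiv.piFinSuccAbove, Fin.insertNthEquiv, add_assoc]
      _ ≤ ∫⁻ v, ENNReal.ofReal (resolventMoment p (t + n * r) (A + Matrix.vecMulVec v v)) ∂ν :=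
          lintegral_mono fun v => ih (hA.add (vecMulVec_self_posSemidef v)) ht
      _ ≤ ENNReal.ofReal (resolventMoment p (t + n * r + r) A) :=
          lintegral_resolventMoment_add_vecMulVec_le hν hL hL0 hA ht₀
            (ht.trans (le_add_of_nonneg_right (by positivity))) hr hp
      _ = _ := by congr 2; push_cast; ring

theorem resolventMoment_zero {t : ℝ} (ht : t ≠ 0) (p : ℕ) :
    resolventMoment p t (0 : Matrix (Fin d) (Fin d) ℝ) = d * (t⁻¹) ^ p := by
  have : (t • (1 : Matrix (Fin d) (Fin d) ℝ))⁻¹ = t⁻¹ • 1 := by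
    apply Matrix.inv_eq_right_inv
    simp [smul_smul, ht]
  rw [resolventMoment, zero_add, this, smul_pow, one_pow, Matrix.trace_smul, Matrix.trace_one]
  simp [mul_comm]

variable {Ω : Type*} [MeasurableSpace Ω] {μ : Measure Ω}

theorem inv_smul_sum_isHermitian {n : ℕ} (x : Fin n → Fin d → ℝ) :
    ((n : ℝ)⁻¹ • ∑ i, Matrix.vecMulVec (x i) (x i)).IsHermitian :=
  ((sum_vecMulVec_posSemidef Finset.univ x).smul (inv_nonneg.2 n.cast_nonneg)).isHermitian

theorem pow_inv_le_resolventMoment_of_lambdaMin_lt (hd : 1 ≤ d) {n : ℕ} (hn : 0 < n)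
    {S : Matrix (Fin d) (Fin d) ℝ} (hS : S.PosSemidef) {b : ℝ}
    (h : lambdaMin ((n : ℝ)⁻¹ • S) < b) (p : ℕ) :
    ((n * (b + 1) : ℝ)⁻¹) ^ p ≤ resolventMoment p n S := by
  have hn' : (0 : ℝ) < n := by exact_mod_cast hn
  have hex : ∃ i, hS.isHermitian.eigenvalues i < n * b := by
    by_contra! hcon
    refine absurd h (not_lt.2 ?_)
    rw [le_lambdaMin_iff_forall_dotProduct hd (hS.smul (inv_nonneg.2 hn'.le)).isHermitian]
    intro x
    have := (le_lambdaMin_iff_forall_dotProduct hd hS.isHermitian (n * b)).1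
      ((le_lambdaMin_iff hd hS.isHermitian _).2 hcon) x
    rw [Matrix.smul_mulVec, dotProduct_smul, smul_eq_mul, le_inv_mul_iff₀ hn']
    linarith
  obtain ⟨i, hi⟩ := hex
  have h0 := hS.eigenvalues_nonneg
  rw [resolventMoment_eq_sum hS hn']
  refine le_trans ?_ (Finset.single_le_sum (f := fun i =>
    ((hS.isHermitian.eigenvalues i + n)⁻¹) ^ p) (fun j _ => pow_nonneg (inv_nonneg.2
      (add_nonneg (h0 j) hn'.le)) _) (Finset.mem_univ i))
  have hpos : 0 < hS.isHermitian.eigenvalues i + n := add_pos_of_nonneg_of_pos (h0 i) hn'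
  refine pow_le_pow_left₀ (inv_nonneg.2 ?_) (inv_anti₀ hpos ?_) p
  · nlinarith
  · nlinarith

/-- Lower tail bound for the smallest eigenvalue of an empirical second-moment matrix of bounded
isotropic vectors. -/
theorem measure_lambdaMin_lt_le [IsProbabilityMeasure μ] (hd : 1 ≤ d) {n : ℕ} (hn : 0 < n)
    {ν : Measure (Fin d → ℝ)}
    [IsProbabilityMeasure ν] (hν : IsIsotropic ν) {L : ℝ} (hL : ∀ᵐ v ∂ν, v ⬝ᵥ v ≤ L) (hL0 : 0 ≤ L)
    {V : Fin n → Ω → Fin d → ℝ} (hV : ∀ i, Measurable (V i)) (hlaw : ∀ i, μ.map (V i) = ν)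
    (hind : iIndepFun V μ) {ε : ℝ} (hε1 : ε ≤ 1) {p : ℕ}
    (hp : p * L / n ≤ ε / 2) :
    μ {ω | lambdaMin ((n : ℝ)⁻¹ • ∑ i, Matrix.vecMulVec (V i ω) (V i ω)) < 1 - ε} ≤
      ENNReal.ofReal (d * (1 - ε / 4) ^ p) := by
  have hn' : (0 : ℝ) < n := by exact_mod_cast hn
  have hpi : μ.map (fun ω i => V i ω) = Measure.pi fun _ : Fin n => ν := by
    rw [(iIndepFun_iff_map_fun_eq_pi_map fun i => (hV i).aemeasurable).1 hind]
    simp [hlaw]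
  have hVm : Measurable fun ω i => V i ω := measurable_pi_lambda _ hV
  have hcont := continuous_resolventMoment_sum (d := d) Matrix.PosSemidef.zero hn' p n
  simp only [zero_add] at hcont
  have hbound := lintegral_pi_resolventMoment_le hν hL hL0 hn' (r := 1 - ε / 2) (by linarith)
    (p := p) (by linarith) n Matrix.PosSemidef.zero le_rfl
  simp only [zero_add] at hbound
  rw [← hpi, lintegral_map hcont.measurable.ennreal_ofReal hVm,
    resolventMoment_zero (by nlinarith)] at hbound
  set y : ℝ := ((n * (2 - ε) : ℝ)⁻¹) ^ p with hy
  have hy0 : 0 < y := pow_pos (inv_pos.2 (mul_pos hn' (by linarith))) _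
  have hsub : {ω | lambdaMin ((n : ℝ)⁻¹ • ∑ i, Matrix.vecMulVec (V i ω) (V i ω)) < 1 - ε} ⊆
      {ω | ENNReal.ofReal y ≤ ENNReal.ofReal
        (resolventMoment p n (∑ i, Matrix.vecMulVec (V i ω) (V i ω)))} := by
    intro ω hω
    have := pow_inv_le_resolventMoment_of_lambdaMin_lt hd hn
      (sum_vecMulVec_posSemidef Finset.univ fun i => V i ω) hω p
    rw [show (1 - ε + 1 : ℝ) = 2 - ε by ring] at this
    exact ENNReal.ofReal_le_ofReal this
  have hmarkov := mul_meas_ge_le_lintegral (μ := μ)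
    (hcont.measurable.ennreal_ofReal.comp hVm) (ENNReal.ofReal y)
  refine (measure_mono hsub).trans ?_
  have h1 := hmarkov.trans hbound
  rw [mul_comm, ← ENNReal.le_div_iff_mul_le (Or.inl (by simpa using hy0))
    (Or.inl ENNReal.ofReal_ne_top), ← ENNReal.ofReal_div_of_pos hy0] at h1
  refine h1.trans (ENNReal.ofReal_le_ofReal ?_)
  rw [mul_div_assoc, hy, ← div_pow]
  -- Amounts to `2 - ε ≤ 2 (1 - ε/4)² = 2 - ε + ε²/8`.
  have hb : (n + n * (1 - ε / 2) : ℝ)⁻¹ / (n * (2 - ε) : ℝ)⁻¹ ≤ 1 - ε / 4 := by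
    rw [div_inv_eq_mul, inv_mul_le_iff₀ (by nlinarith)]
    nlinarith [mul_nonneg hn'.le (sq_nonneg ε)]
  gcongr
  exact div_nonneg (inv_nonneg.2 (by nlinarith)) (inv_nonneg.2 (by nlinarith))

end WhitenedGram

/-! ### Second-moment tail bound through the Frobenius norm. -/

namespace WhitenedGram

variable {d : ℕ}

/-- Cauchy–Schwarz over pairs of indices. -/
theorem sq_dotProduct_mulVec_le (E : Matrix (Fin d) (Fin d) ℝ) (x : Fin d → ℝ) :
    (x ⬝ᵥ E *ᵥ x) ^ 2 ≤ (∑ i, ∑ j, E i j ^ 2) * (x ⬝ᵥ x) ^ 2 := by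
  rw [dotProduct_mulVec_eq_sum, ← Fintype.sum_prod_type' (fun i j => E i j * (x i * x j)),
    ← Fintype.sum_prod_type' (fun i j => E i j ^ 2)]
  refine (Finset.sum_mul_sq_le_sq_mul_sq _ _ _).trans_eq ?_
  congr 1
  rw [Fintype.sum_prod_type, sq, dotProduct, Finset.sum_mul_sum]
  exact Finset.sum_congr rfl fun i _ => Finset.sum_congr rfl fun j _ => by ring

/-- Deviation of the smallest eigenvalue from `1`, in terms of the Frobenius norm. -/
theorem sq_le_sum_sq_sub_one_of_lambdaMin_lt (hd : 1 ≤ d) {M : Matrix (Fin d) (Fin d) ℝ}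
    (hM : M.IsHermitian) {ε : ℝ} (hε : 0 ≤ ε) (h : lambdaMin M < 1 - ε) :
    ε ^ 2 ≤ ∑ i, ∑ j, (M i j - (1 : Matrix (Fin d) (Fin d) ℝ) i j) ^ 2 := by
  rw [← not_le, le_lambdaMin_iff_forall_dotProduct hd hM] at h
  push Not at h
  obtain ⟨x, hx⟩ := h
  have h1 := sq_dotProduct_mulVec_le (M - 1) x
  rw [Matrix.sub_mulVec, Matrix.one_mulVec, dotProduct_sub] at h1
  simp only [Matrix.sub_apply] at h1
  have hx0 : 0 ≤ x ⬝ᵥ x := by simpa using dotProduct_star_self_nonneg x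
  have h2 : (ε * (x ⬝ᵥ x)) ^ 2 < (x ⬝ᵥ M *ᵥ x - x ⬝ᵥ x) ^ 2 := by
    rw [← sq_abs (x ⬝ᵥ M *ᵥ x - x ⬝ᵥ x)]
    have h0 : 0 ≤ ε * (x ⬝ᵥ x) := mul_nonneg hε hx0
    refine pow_lt_pow_left₀ ?_ h0 two_ne_zero
    rw [lt_abs]
    right
    linarith
  have h3 : 0 < (x ⬝ᵥ x) ^ 2 := by
    rcases hx0.eq_or_lt with h0 | h0
    · rw [← h0] at h1 h2
      exfalso
      nlinarith
    · positivity
  rw [mul_pow] at h2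
  exact le_of_mul_le_mul_right (h2.le.trans h1) h3

variable {Ω : Type*} [MeasurableSpace Ω] {μ : Measure Ω}

theorem memLp_two_mul_of_integrable_sq {ν : Measure (Fin d → ℝ)}
    (hq : Integrable (fun v => (v ⬝ᵥ v) ^ 2) ν) (i j : Fin d) :
    MemLp (fun v => v i * v j) 2 ν := by
  have hm : AEStronglyMeasurable (fun v : Fin d → ℝ => v i * v j) ν :=
    ((continuous_apply i).mul (continuous_apply j)).aestronglyMeasurable
  rw [memLp_two_iff_integrable_sq hm]
  refine hq.mono (hm.pow 2) (Eventually.of_forall fun v => ?_)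
  have hle : ∀ k, v k ^ 2 ≤ v ⬝ᵥ v := fun k => by
    simpa [dotProduct, sq] using Finset.single_le_sum (f := fun k => v k * v k)
      (fun k _ => mul_self_nonneg _) (Finset.mem_univ k)
  rw [Real.norm_of_nonneg (sq_nonneg _), Real.norm_of_nonneg (sq_nonneg _), mul_pow, sq (v ⬝ᵥ v)]
  exact mul_le_mul (hle i) (hle j) (sq_nonneg _) ((sq_nonneg _).trans (hle i))

/-- Second moment of the deviation of an entry of the empirical second-moment matrix. -/
theorem IsIsotropic.integral_sq_entry_sub_le [IsProbabilityMeasure μ] {n : ℕ} (hn : 0 < n)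
    {ν : Measure (Fin d → ℝ)} [IsProbabilityMeasure ν] (hν : IsIsotropic ν)
    (hq : Integrable (fun v => (v ⬝ᵥ v) ^ 2) ν)
    {V : Fin n → Ω → Fin d → ℝ} (hV : ∀ i, Measurable (V i)) (hlaw : ∀ i, μ.map (V i) = ν)
    (hind : iIndepFun V μ) (i j : Fin d) :
    Integrable (fun ω => (((n : ℝ)⁻¹ • ∑ k, Matrix.vecMulVec (V k ω) (V k ω)) i j -
        (1 : Matrix (Fin d) (Fin d) ℝ) i j) ^ 2) μ ∧
      ∫ ω, (((n : ℝ)⁻¹ • ∑ k, Matrix.vecMulVec (V k ω) (V k ω)) i j -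
        (1 : Matrix (Fin d) (Fin d) ℝ) i j) ^ 2 ∂μ ≤ (n : ℝ)⁻¹ * ∫ v, (v i * v j) ^ 2 ∂ν := by
  have hn' : (n : ℝ) ≠ 0 := by exact_mod_cast hn.ne'
  have hf := memLp_two_mul_of_integrable_sq hq i j
  set f : (Fin d → ℝ) → ℝ := fun v => v i * v j with hfdef
  have hfm : Measurable f := ((continuous_apply i).mul (continuous_apply j)).measurable
  have hY : ∀ k, MemLp (f ∘ V k) 2 μ := fun k => by
    rw [← memLp_map_measure_iff hfm.aestronglyMeasurable (hV k).aemeasurable, hlaw]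
    exact hf
  have hint : ∀ g : (Fin d → ℝ) → ℝ, Measurable g → ∀ k, ∫ ω, g (V k ω) ∂μ = ∫ v, g v ∂ν :=
    fun g hg k => by rw [← hlaw k, integral_map (hV k).aemeasurable hg.aestronglyMeasurable]
  have hmean : ∀ k, ∫ ω, (f ∘ V k) ω ∂μ = (1 : Matrix (Fin d) (Fin d) ℝ) i j := fun k =>
    (hint f hfm k).trans (hν.integral_mul i j)
  have hvar : ∀ k, Var[f ∘ V k; μ] ≤ ∫ v, f v ^ 2 ∂ν := fun k =>
    (variance_le_expectation_sq (hY k).aestronglyMeasurable).trans_eq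
      (hint (fun v => f v ^ 2) (hfm.pow_const 2) k)
  have hentry : ∀ ω, ((n : ℝ)⁻¹ • ∑ k, Matrix.vecMulVec (V k ω) (V k ω)) i j =
      (n : ℝ)⁻¹ * (∑ k, f ∘ V k) ω := fun ω => by
    simp [Matrix.sum_apply, Matrix.vecMulVec_apply, hfdef]
  have hsumLp : MemLp (∑ k, f ∘ V k) 2 μ := memLp_finsetSum' _ fun k _ => hY k
  have hLp : MemLp (fun ω => (n : ℝ)⁻¹ * (∑ k, f ∘ V k) ω) 2 μ := hsumLp.const_mul _
  have hmeanM : ∫ ω, (n : ℝ)⁻¹ * (∑ k, f ∘ V k) ω ∂μ = (1 : Matrix (Fin d) (Fin d) ℝ) i j := by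
    rw [integral_const_mul]
    simp only [Finset.sum_apply]
    rw [integral_finsetSum _ fun k _ => (hY k).integrable one_le_two]
    simp only [hmean]
    simp [hn']
  simp only [hentry]
  refine ⟨(memLp_two_iff_integrable_sq (hLp.sub (memLp_const _)).aestronglyMeasurable).1
    (hLp.sub (memLp_const _)), ?_⟩
  -- By isotropy the entry has mean `δ_ij`, so its mean square deviation is a variance, additive
  -- under independence.
  have hV1 : ∫ ω, ((n : ℝ)⁻¹ * (∑ k, f ∘ V k) ω - (1 : Matrix (Fin d) (Fin d) ℝ) i j) ^ 2 ∂μ =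
      Var[fun ω => (n : ℝ)⁻¹ * (∑ k, f ∘ V k) ω; μ] := by
    rw [variance_eq_integral hLp.aestronglyMeasurable.aemeasurable, hmeanM]
  rw [hV1, variance_const_mul, IndepFun.variance_sum (fun k _ => hY k) fun k _ l _ hkl =>
    (hind.comp (fun _ => f) fun _ => hfm).indepFun hkl]
  calc (n : ℝ)⁻¹ ^ 2 * ∑ k, Var[f ∘ V k; μ] ≤ (n : ℝ)⁻¹ ^ 2 * ∑ _k : Fin n, ∫ v, f v ^ 2 ∂ν := by
        gcongr with k; exact hvar k
    _ = (n : ℝ)⁻¹ * ∫ v, f v ^ 2 ∂ν := by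
        rw [Finset.sum_const, Finset.card_univ, Fintype.card_fin, nsmul_eq_mul]
        field_simp

/-- Lower tail bound for the smallest eigenvalue of an empirical second-moment matrix of isotropic
vectors with finite fourth moment. -/
theorem measureReal_lambdaMin_lt_le [IsProbabilityMeasure μ] (hd : 1 ≤ d) {n : ℕ} (hn : 0 < n)
    {ν : Measure (Fin d → ℝ)} [IsProbabilityMeasure ν] (hν : IsIsotropic ν)
    (hq : Integrable (fun v => (v ⬝ᵥ v) ^ 2) ν)
    {V : Fin n → Ω → Fin d → ℝ} (hV : ∀ i, Measurable (V i)) (hlaw : ∀ i, μ.map (V i) = ν)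
    (hind : iIndepFun V μ) {ε : ℝ} (hε : 0 < ε) :
    μ.real {ω | lambdaMin ((n : ℝ)⁻¹ • ∑ i, Matrix.vecMulVec (V i ω) (V i ω)) < 1 - ε} ≤
      (∫ v, (v ⬝ᵥ v) ^ 2 ∂ν) / n / ε ^ 2 := by
  have hent := hν.integral_sq_entry_sub_le hn hq hV hlaw hind
  set T : Ω → ℝ := fun ω => ∑ i, ∑ j, (((n : ℝ)⁻¹ • ∑ k, Matrix.vecMulVec (V k ω) (V k ω)) i j -
        (1 : Matrix (Fin d) (Fin d) ℝ) i j) ^ 2 with hT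
  have hTint : Integrable T μ :=
    integrable_finsetSum _ fun i _ => integrable_finsetSum _ fun j _ => (hent i j).1
  have hTnn : 0 ≤ T := fun ω => Finset.sum_nonneg fun i _ => Finset.sum_nonneg fun j _ => sq_nonneg _
  have hsq : ∀ i j, Integrable (fun v : Fin d → ℝ => (v i * v j) ^ 2) ν := fun i j =>
    (memLp_two_mul_of_integrable_sq hq i j).integrable_sq
  have hTle : ∫ ω, T ω ∂μ ≤ (∫ v, (v ⬝ᵥ v) ^ 2 ∂ν) / n := by
    have e : ∫ v, (v ⬝ᵥ v) ^ 2 ∂ν = ∑ i, ∑ j, ∫ v, (v i * v j) ^ 2 ∂ν := by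
      have : ∀ v : Fin d → ℝ, (v ⬝ᵥ v) ^ 2 = ∑ i, ∑ j, (v i * v j) ^ 2 := fun v => by
        rw [sq, dotProduct, Finset.sum_mul_sum]
        exact Finset.sum_congr rfl fun i _ => Finset.sum_congr rfl fun j _ => by ring
      simp only [this]
      refine (integral_finsetSum _ fun i _ => integrable_finsetSum _ fun j _ => hsq i j).trans
        (Finset.sum_congr rfl fun i _ => integral_finsetSum _ fun j _ => hsq i j)
    rw [e, div_eq_inv_mul, Finset.mul_sum]
    simp only [Finset.mul_sum, hT]
    rw [integral_finsetSum _ fun i _ => integrable_finsetSum _ fun j _ => (hent i j).1]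
    refine Finset.sum_le_sum fun i _ => ?_
    rw [integral_finsetSum _ fun j _ => (hent i j).1]
    exact Finset.sum_le_sum fun j _ => (hent i j).2
  have hmarkov := mul_meas_ge_le_integral_of_nonneg (μ := μ) (Eventually.of_forall hTnn) hTint
    (ε ^ 2)
  rw [le_div_iff₀ (by positivity), mul_comm]
  refine le_trans (mul_le_mul_of_nonneg_left (measureReal_mono fun ω hω => ?_) (sq_nonneg _))
    (hmarkov.trans hTle)
  exact sq_le_sum_sq_sub_one_of_lambdaMin_lt hd (inv_smul_sum_isHermitian _) hε.le hω

end WhitenedGram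

/-! ### Whitening, and the limits under the two growth conditions. -/

namespace WhitenedGram

variable {d : ℕ} {𝒳 : Type*} [MeasurableSpace 𝒳] {P : Measure 𝒳}

theorem integrable_mul_of_memLp {h : 𝒳 → Fin d → ℝ} (hL2 : ∀ j, MemLp (fun x => h x j) 2 P)
    (i j : Fin d) : Integrable (fun x => h x i * h x j) P :=
  (hL2 i).integrable_mul (hL2 j)

theorem dotProduct_gram_mulVec {h : 𝒳 → Fin d → ℝ} (hL2 : ∀ j, MemLp (fun x => h x j) 2 P)
    (c : Fin d → ℝ) : c ⬝ᵥ gram P h *ᵥ c = ∫ x, (c ⬝ᵥ h x) ^ 2 ∂P := by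
  have e : ∀ x, (c ⬝ᵥ h x) ^ 2 = ∑ i, ∑ j, h x i * h x j * (c i * c j) := fun x => by
    rw [sq, dotProduct, Finset.sum_mul_sum]
    exact Finset.sum_congr rfl fun i _ => Finset.sum_congr rfl fun j _ => by ring
  have hint := integrable_mul_of_memLp hL2
  simp only [e]
  rw [dotProduct_mulVec_eq_sum, integral_finsetSum _ fun i _ => integrable_finsetSum _ fun j _ =>
    (hint i j).mul_const _]
  refine Finset.sum_congr rfl fun i _ => ?_
  rw [integral_finsetSum _ fun j _ => (hint i j).mul_const _]
  exact Finset.sum_congr rfl fun j _ => (integral_mul_const _ _).symm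

theorem gram_posSemidef {h : 𝒳 → Fin d → ℝ} (hL2 : ∀ j, MemLp (fun x => h x j) 2 P) :
    (gram P h).PosSemidef := by
  refine Matrix.PosSemidef.of_dotProduct_mulVec_nonneg ?_ fun c => ?_
  · ext i j
    simp [gram, mul_comm]
  · rw [star_trivial, dotProduct_gram_mulVec hL2]
    exact integral_nonneg fun x => sq_nonneg _

theorem inv_sqrt_gram_mul_gram_mul {h : 𝒳 → Fin d → ℝ} (hL2 : ∀ j, MemLp (fun x => h x j) 2 P)
    (hG : IsUnit (gram P h)) :
    (CFC.sqrt (gram P h))⁻¹ * gram P h * ((CFC.sqrt (gram P h))⁻¹)ᵀ = 1 := by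
  have hpos := gram_posSemidef hL2
  have hs : CFC.sqrt (gram P h) * CFC.sqrt (gram P h) = gram P h :=
    CFC.sqrt_mul_sqrt_self _ (Matrix.nonneg_iff_posSemidef.2 hpos)
  have hsymm : (CFC.sqrt (gram P h))ᵀ = CFC.sqrt (gram P h) :=
    (Matrix.nonneg_iff_posSemidef.1 (CFC.sqrt_nonneg (gram P h))).isHermitian
  have hu : IsUnit (CFC.sqrt (gram P h)).det := by
    rw [Matrix.isUnit_iff_isUnit_det, ← hs, Matrix.det_mul] at hG
    exact isUnit_of_mul_isUnit_left hG
  rw [Matrix.transpose_nonsing_inv, hsymm]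
  conv_lhs => enter [1, 2]; rw [← hs]
  rw [← mul_assoc, Matrix.nonsing_inv_mul _ hu, one_mul, Matrix.mul_nonsing_inv _ hu]

theorem measurable_whiten {h : 𝒳 → Fin d → ℝ} (hm : Measurable h) : Measurable (whiten P h) := by
  have : Continuous fun v : Fin d → ℝ => (CFC.sqrt (gram P h))⁻¹ *ᵥ v :=
    Continuous.matrix_mulVec continuous_const continuous_id
  exact this.measurable.comp hm

/-- The Gram matrix transforms as `W G Wᵀ`; the inverse square root is one choice of `W`. -/
theorem isIsotropic_map_mulVec {h : 𝒳 → Fin d → ℝ} (hm : Measurable h)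
    (hL2 : ∀ j, MemLp (fun x => h x j) 2 P) {W : Matrix (Fin d) (Fin d) ℝ}
    (hW : W * gram P h * Wᵀ = 1) : IsIsotropic (P.map fun x => W *ᵥ h x) := by
  have hgm : Measurable fun x => W *ᵥ h x :=
    (Continuous.matrix_mulVec continuous_const continuous_id).measurable.comp hm
  have hint := integrable_mul_of_memLp hL2
  have hmul : ∀ i j, Measurable fun v : Fin d → ℝ => v i * v j := fun i j =>
    (measurable_pi_apply i).mul (measurable_pi_apply j)
  have e : ∀ i j x, (W *ᵥ h x) i * (W *ᵥ h x) j =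
      ∑ k, ∑ l, W i k * W j l * (h x k * h x l) := fun i j x => by
    simp only [Matrix.mulVec, dotProduct]
    rw [Finset.sum_mul_sum]
    exact Finset.sum_congr rfl fun k _ => Finset.sum_congr rfl fun l _ => by ring
  constructor
  · intro i j
    rw [integrable_map_measure (hmul i j).aestronglyMeasurable hgm.aemeasurable]
    simp only [Function.comp_def, e]
    exact integrable_finsetSum _ fun k _ => integrable_finsetSum _ fun l _ => (hint k l).const_mul _
  · intro i j
    rw [integral_map hgm.aemeasurable (hmul i j).aestronglyMeasurable]
    simp only [e]
    rw [integral_finsetSum _ fun k _ => integrable_finsetSum _ fun l _ => (hint k l).const_mul _,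
      ← hW, Matrix.mul_apply]
    simp only [Matrix.mul_apply, Finset.sum_mul, Matrix.transpose_apply]
    rw [Finset.sum_comm]
    refine Finset.sum_congr rfl fun k _ => ?_
    rw [integral_finsetSum _ fun l _ => (hint k l).const_mul _]
    refine Finset.sum_congr rfl fun l _ => ?_
    rw [integral_const_mul, gram, Matrix.of_apply]
    ring

theorem isIsotropic_map_whiten {h : 𝒳 → Fin d → ℝ} (hm : Measurable h)
    (hL2 : ∀ j, MemLp (fun x => h x j) 2 P) (hG : IsUnit (gram P h)) :
    IsIsotropic (P.map (whiten P h)) :=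
  isIsotropic_map_mulVec hm hL2 (inv_sqrt_gram_mul_gram_mul hL2 hG)

variable {Ω : Type*} [MeasurableSpace Ω] {μ : Measure Ω}

/-- `b ≤ λ_min` is an intersection of closed conditions on the sample vectors, one for each test
vector `y`. -/
theorem measurable_lambdaMin_empGram (hd : 1 ≤ d) {n : ℕ} {X : Fin n → Ω → 𝒳}
    {g : 𝒳 → Fin d → ℝ} (hg : Measurable g) (hX : ∀ i, Measurable (X i)) :
    Measurable fun ω => lambdaMin (empGram (fun i => X i ω) g) := by
  refine measurable_of_Ici fun b => ?_
  have hS : Continuous fun x : Fin n → Fin d → ℝ => ∑ i, Matrix.vecMulVec (x i) (x i) :=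
    continuous_finsetSum _ fun i _ =>
      Continuous.matrix_vecMulVec (continuous_apply i) (continuous_apply i)
  have hcl : IsClosed {x : Fin n → Fin d → ℝ | ∀ y, b * (y ⬝ᵥ y) ≤
      y ⬝ᵥ ((n : ℝ)⁻¹ • ∑ i, Matrix.vecMulVec (x i) (x i)) *ᵥ y} := by
    simp only [Set.ofPred_forall]
    refine isClosed_iInter fun y => isClosed_le continuous_const ?_
    refine Continuous.dotProduct continuous_const (Continuous.matrix_mulVec ?_ continuous_const)
    exact hS.const_smul ((n : ℝ)⁻¹)
  have hm : Measurable fun ω i => g (X i ω) := measurable_pi_lambda _ fun i => hg.comp (hX i)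
  convert hm hcl.measurableSet using 1
  ext ω
  exact le_lambdaMin_iff_forall_dotProduct hd (inv_smul_sum_isHermitian fun i => g (X i ω)) b

theorem dotProduct_le_toReal_supNorm {𝒳 : Type*} {g : 𝒳 → Fin d → ℝ}
    (hfin : supNorm (fun x => g x ⬝ᵥ g x) ≠ ∞) (x : 𝒳) :
    g x ⬝ᵥ g x ≤ (supNorm fun x => g x ⬝ᵥ g x).toReal :=
  (le_abs_self _).trans ((ENNReal.ofReal_le_iff_le_toReal hfin).1
    (le_iSup (fun x => ENNReal.ofReal |g x ⬝ᵥ g x|) x))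

/-- From `1 - x ≤ exp (-x)`, this exponent makes the power at most `(2D)⁻⁽ʲ⁺¹⁾`. -/
theorem mul_pow_ceil_le_half_pow {D ε : ℝ} (hD : 1 ≤ D) (hε0 : 0 < ε) (hε1 : ε ≤ 1) (j : ℕ) :
    D * (1 - ε / 4) ^ ⌈4 * (j + 1) / ε * Real.log (2 * D)⌉₊ ≤ (1 / 2) ^ j := by
  set p := ⌈4 * (j + 1) / ε * Real.log (2 * D)⌉₊
  have hp : 4 * (j + 1) / ε * Real.log (2 * D) ≤ p := Nat.le_ceil _
  have h1 : (1 - ε / 4) ^ p ≤ Real.exp (-(ε / 4)) ^ p :=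
    pow_le_pow_left₀ (by linarith) (Real.one_sub_le_exp_neg _) p
  have h2 : Real.exp (-(ε / 4)) ^ p ≤ ((2 * D) ^ (j + 1))⁻¹ := by
    have e : (2 * D) ^ (j + 1) = Real.exp ((j + 1 : ℕ) * Real.log (2 * D)) := by
      rw [Real.exp_nat_mul, Real.exp_log (by linarith)]
    rw [← Real.exp_nat_mul, e, ← Real.exp_neg]
    refine Real.exp_le_exp.2 ?_
    have := mul_le_mul_of_nonneg_right hp (by positivity : 0 ≤ ε / 4)
    have e : 4 * (j + 1) / ε * Real.log (2 * D) * (ε / 4) = (j + 1) * Real.log (2 * D) := by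
      field_simp
    push_cast
    linarith
  have hD0 : 0 < D := by linarith
  calc D * (1 - ε / 4) ^ p ≤ D * ((2 * D) ^ (j + 1))⁻¹ := by gcongr; exact h1.trans h2
    _ = 2⁻¹ * ((2 * D) ^ j)⁻¹ := by rw [pow_succ]; field_simp
    _ ≤ 1 * (2 ^ j)⁻¹ := by
        gcongr
        · norm_num
        · linarith
    _ = _ := by simp

variable {d : ℕ → ℕ} {h : (n : ℕ) → 𝒳 → Fin (d n) → ℝ} {X : (n : ℕ) → Fin n → Ω → 𝒳}

/-- The probability that the smallest eigenvalue is below `1 - ε` vanishes when the leverage has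
second moment `o(n)`. -/
theorem tendsto_measure_lambdaMin_lt_of_lintegral [IsProbabilityMeasure P] [IsProbabilityMeasure μ]
    (hX_meas : ∀ n i, Measurable (X n i)) (hX_law : ∀ n i, μ.map (X n i) = P)
    (hX_indep : ∀ n, iIndepFun (X n) μ) (hd : ∀ n, 1 ≤ d n) (hh_meas : ∀ n, Measurable (h n))
    (hh_L2 : ∀ n j, MemLp (fun x => h n x j) 2 P) (hh_gram : ∀ n, IsUnit (gram P (h n)))
    (hq : Tendsto (fun n : ℕ =>
      (∫⁻ x, ENNReal.ofReal (leverage P (h n) x ^ 2) ∂P) / (n : ℝ≥0∞)) atTop (𝓝 0))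
    {ε : ℝ} (hε : 0 < ε) :
    Tendsto (fun n => μ {ω | lambdaMin (empGram (fun i => X n i ω) (whiten P (h n))) < 1 - ε})
      atTop (𝓝 0) := by
  have hlim := ENNReal.Tendsto.div_const hq (b := ENNReal.ofReal (ε ^ 2))
    (Or.inr (ENNReal.ofReal_pos.2 (sq_pos_of_pos hε)).ne')
  rw [ENNReal.zero_div] at hlim
  refine tendsto_of_tendsto_of_tendsto_of_le_of_le' tendsto_const_nhds hlim
    (Eventually.of_forall fun _ => zero_le) ?_
  filter_upwards [hq.eventually (gt_mem_nhds ENNReal.zero_lt_top), eventually_gt_atTop 0]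
    with n hn hn0
  have hg := measurable_whiten (P := P) (hh_meas n)
  have hsq : Measurable fun v : Fin (d n) → ℝ => (v ⬝ᵥ v) ^ 2 :=
    ((continuous_id.dotProduct continuous_id).pow 2).measurable
  -- Finiteness is not assumed: it holds once the ratio to the finite `n` is finite.
  have hfin : ∫⁻ x, ENNReal.ofReal (leverage P (h n) x ^ 2) ∂P < ∞ := by
    by_contra hcon
    rw [not_lt, top_le_iff] at hcon
    rw [hcon, ENNReal.top_div_of_ne_top (ENNReal.natCast_ne_top n)] at hn
    exact lt_irrefl _ hn
  have hprob : IsProbabilityMeasure (P.map (whiten P (h n))) :=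
    Measure.isProbabilityMeasure_map hg.aemeasurable
  have hl : ∫⁻ v, ENNReal.ofReal ((v ⬝ᵥ v) ^ 2) ∂(P.map (whiten P (h n))) =
      ∫⁻ x, ENNReal.ofReal (leverage P (h n) x ^ 2) ∂P :=
    lintegral_map hsq.ennreal_ofReal hg
  have hint : Integrable (fun v => (v ⬝ᵥ v) ^ 2) (P.map (whiten P (h n))) :=
    (lintegral_ofReal_ne_top_iff_integrable hsq.aestronglyMeasurable
      (Eventually.of_forall fun v => sq_nonneg _)).1 (hl ▸ hfin.ne)
  have key := measureReal_lambdaMin_lt_le (μ := μ) (hd n) hn0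
    (isIsotropic_map_whiten (hh_meas n) (hh_L2 n) (hh_gram n)) hint
    (V := fun i ω => whiten P (h n) (X n i ω)) (fun i => hg.comp (hX_meas n i))
    (fun i => (Measure.map_map hg (hX_meas n i)).symm.trans (by rw [hX_law]))
    ((hX_indep n).comp (fun _ => whiten P (h n)) fun _ => hg) hε
  have h2 := ENNReal.ofReal_le_ofReal key
  rw [ofReal_measureReal, ENNReal.ofReal_div_of_pos (by positivity),
    ENNReal.ofReal_div_of_pos (by exact_mod_cast hn0), ENNReal.ofReal_natCast,
    ofReal_integral_eq_lintegral_ofReal hint (Eventually.of_forall fun v => sq_nonneg _), hl] at h2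
  exact h2

/-- The probability that the smallest eigenvalue is below `1 - ε` vanishes when the leverage is
uniformly `o(n / log (2 d))`. -/
theorem tendsto_measure_lambdaMin_lt_of_supNorm [IsProbabilityMeasure P] [IsProbabilityMeasure μ]
    (hX_meas : ∀ n i, Measurable (X n i)) (hX_law : ∀ n i, μ.map (X n i) = P)
    (hX_indep : ∀ n, iIndepFun (X n) μ) (hd : ∀ n, 1 ≤ d n) (hh_meas : ∀ n, Measurable (h n))
    (hh_L2 : ∀ n j, MemLp (fun x => h n x j) 2 P) (hh_gram : ∀ n, IsUnit (gram P (h n)))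
    (hq : Tendsto (fun n : ℕ => supNorm (leverage P (h n)) *
      ENNReal.ofReal (Real.log (2 * (d n : ℝ))) / (n : ℝ≥0∞)) atTop (𝓝 0))
    {ε : ℝ} (hε0 : 0 < ε) (hε1 : ε ≤ 1) :
    Tendsto (fun n => μ {ω | lambdaMin (empGram (fun i => X n i ω) (whiten P (h n))) < 1 - ε})
      atTop (𝓝 0) := by
  rw [ENNReal.tendsto_nhds_zero]
  intro δ hδ
  obtain ⟨j, hj⟩ : ∃ j : ℕ, ENNReal.ofReal ((1 / 2) ^ j) ≤ δ := by
    have : Tendsto (fun j : ℕ => ENNReal.ofReal ((1 / 2) ^ j)) atTop (𝓝 0) := by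
      simpa using ENNReal.tendsto_ofReal
        (tendsto_pow_atTop_nhds_zero_of_lt_one (by norm_num : (0 : ℝ) ≤ 1 / 2) (by norm_num))
    exact ((ENNReal.tendsto_nhds_zero.1 this) δ hδ).exists
  set K : ℝ := 4 * (j + 1) / ε with hK
  have hK0 : 0 < K := by positivity
  -- Rounding `K log (2d)` up adds less than `1`, and `1 < 2 log (2d)`; hence `K + 2`.
  have hη : 0 < ε / 2 / (K + 2) := by positivity
  filter_upwards [(ENNReal.tendsto_nhds_zero.1 hq) (ENNReal.ofReal (ε / 2 / (K + 2)))
    (by simpa using hη), eventually_gt_atTop 0] with n hn hn0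
  have hn' : (0 : ℝ) < n := by exact_mod_cast hn0
  have hd1 : (1 : ℝ) ≤ d n := by exact_mod_cast hd n
  have hlog : 1 / 2 < Real.log (2 * d n) :=
    lt_of_lt_of_le (by linarith [Real.log_two_gt_d9])
      (Real.log_le_log two_pos (by linarith : (2 : ℝ) ≤ 2 * d n))
  have hg := measurable_whiten (P := P) (hh_meas n)
  -- Strict positivity of the logarithm matters here, since `∞ * 0 = 0` in `ℝ≥0∞`.
  have hfin : supNorm (leverage P (h n)) ≠ ∞ := by
    intro hcon
    rw [hcon, ENNReal.top_mul (by simpa using lt_trans (by norm_num) hlog),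
      ENNReal.top_div_of_ne_top (ENNReal.natCast_ne_top n)] at hn
    exact ENNReal.ofReal_ne_top (top_le_iff.1 hn)
  set L : ℝ := (supNorm (leverage P (h n))).toReal with hLdef
  have hL0 : 0 ≤ L := ENNReal.toReal_nonneg
  have hreal : L * Real.log (2 * d n) / n ≤ ε / 2 / (K + 2) := by
    have := ENNReal.toReal_mono ENNReal.ofReal_ne_top hn
    rwa [ENNReal.toReal_div, ENNReal.toReal_mul, ENNReal.toReal_ofReal (by linarith),
      ENNReal.toReal_ofReal hη.le, ENNReal.toReal_natCast] at this
  have hprob : IsProbabilityMeasure (P.map (whiten P (h n))) :=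
    Measure.isProbabilityMeasure_map hg.aemeasurable
  have hbound : ∀ᵐ v ∂(P.map (whiten P (h n))), v ⬝ᵥ v ≤ L := by
    have hc : Continuous fun v : Fin (d n) → ℝ => v ⬝ᵥ v := continuous_id.dotProduct continuous_id
    rw [ae_map_iff hg.aemeasurable (measurableSet_le hc.measurable measurable_const)]
    exact Eventually.of_forall fun x => dotProduct_le_toReal_supNorm hfin x
  have hp : (⌈K * Real.log (2 * d n)⌉₊ : ℝ) * L / n ≤ ε / 2 := by
    have h1 : (⌈K * Real.log (2 * d n)⌉₊ : ℝ) ≤ (K + 2) * Real.log (2 * d n) := by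
      have := Nat.ceil_lt_add_one (a := K * Real.log (2 * d n)) (by positivity)
      linarith
    rw [le_div_iff₀ (by positivity)] at hreal
    calc (⌈K * Real.log (2 * d n)⌉₊ : ℝ) * L / n ≤ (K + 2) * Real.log (2 * d n) * L / n := by gcongr
      _ = L * Real.log (2 * d n) / n * (K + 2) := by ring
      _ ≤ ε / 2 := hreal
  refine le_trans ?_ hj
  refine (measure_lambdaMin_lt_le (μ := μ) (hd n) hn0
    (isIsotropic_map_whiten (hh_meas n) (hh_L2 n) (hh_gram n)) hbound hL0
    (V := fun i ω => whiten P (h n) (X n i ω)) (fun i => hg.comp (hX_meas n i))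
    (fun i => (Measure.map_map hg (hX_meas n i)).symm.trans (by rw [hX_law]))
    ((hX_indep n).comp (fun _ => whiten P (h n)) fun _ => hg) hε1 hp).trans ?_
  exact ENNReal.ofReal_le_ofReal (mul_pow_ceil_le_half_pow hd1 hε0 hε1 j)

end WhitenedGram

/-! ### From the tail probabilities to the two conclusions. -/

theorem lemma1
    {𝒳 Ω : Type*} [MeasurableSpace 𝒳] [MeasurableSpace Ω]
    -- the input distribution `P` and the probability `μ` on the underlying space `Ω`
    (P : Measure 𝒳) [IsProbabilityMeasure P]
    (μ : Measure Ω) [IsProbabilityMeasure μ]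
    -- for every `n`, the training sample `X n 0, …, X n (n - 1)` is i.i.d. with law `P`
    (X : (n : ℕ) → Fin n → Ω → 𝒳)
    (hX_meas : ∀ n i, Measurable (X n i))
    (hX_law : ∀ n i, μ.map (X n i) = P)
    (hX_indep : ∀ n, iIndepFun (X n) μ)
    -- feature maps with finite second moments and invertible Gram matrix
    (d : ℕ → ℕ) (hd : ∀ n, 1 ≤ d n)
    (h : (n : ℕ) → 𝒳 → Fin (d n) → ℝ)
    (hh_meas : ∀ n, Measurable (h n))
    (hh_L2 : ∀ n j, MemLp (fun x => h n x j) 2 P)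
    (hh_gram : ∀ n, IsUnit (WhitenedGram.gram P (h n)))
    -- (a) `P(q_n²) = o(n)` or (b) `‖q_n‖_∞ log(2 d_n) = o(n)`
    (hq :
      Tendsto (fun n : ℕ =>
          (∫⁻ x, ENNReal.ofReal (WhitenedGram.leverage P (h n) x ^ 2) ∂P) / (n : ℝ≥0∞))
        atTop (𝓝 0) ∨
      Tendsto (fun n : ℕ =>
          WhitenedGram.supNorm (WhitenedGram.leverage P (h n)) *
            ENNReal.ofReal (Real.log (2 * (d n : ℝ))) / (n : ℝ≥0∞))
        atTop (𝓝 0)) :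
    -- invertibility with probability tending to one
    Tendsto (fun n : ℕ => μ {ω | IsUnit
        (WhitenedGram.empGram (fun i => X n i ω) (WhitenedGram.whiten P (h n)))})
      atTop (𝓝 1) ∧
    -- `λ_min ≥ 1 + o_P(1)`
    ∃ R : ℕ → Ω → ℝ, (∀ n, Measurable (R n)) ∧ TendstoInMeasure μ R atTop (fun _ => 0) ∧
      ∀ n ω, 1 + R n ω ≤ WhitenedGram.lambdaMin
        (WhitenedGram.empGram (fun i => X n i ω) (WhitenedGram.whiten P (h n))) := by

  have hherm : ∀ n ω, (WhitenedGram.empGram (fun i => X n i ω)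
      (WhitenedGram.whiten P (h n))).IsHermitian := fun n ω =>
    WhitenedGram.inv_smul_sum_isHermitian fun i => WhitenedGram.whiten P (h n) (X n i ω)
  have hmeas : ∀ n, Measurable fun ω => WhitenedGram.lambdaMin
      (WhitenedGram.empGram (fun i => X n i ω) (WhitenedGram.whiten P (h n))) := fun n =>
    WhitenedGram.measurable_lambdaMin_empGram (hd n) (WhitenedGram.measurable_whiten (hh_meas n))
      (hX_meas n)
  have htail : ∀ ε : ℝ, 0 < ε → ε ≤ 1 → Tendsto (fun n => μ {ω | WhitenedGram.lambdaMin
      (WhitenedGram.empGram (fun i => X n i ω) (WhitenedGram.whiten P (h n))) < 1 - ε})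
      atTop (𝓝 0) := by
    intro ε hε0 hε1
    rcases hq with hq | hq
    · exact WhitenedGram.tendsto_measure_lambdaMin_lt_of_lintegral hX_meas hX_law hX_indep hd
        hh_meas hh_L2 hh_gram hq hε0
    · exact WhitenedGram.tendsto_measure_lambdaMin_lt_of_supNorm hX_meas hX_law hX_indep hd
        hh_meas hh_L2 hh_gram hq hε0 hε1
  refine ⟨?_, fun n ω => min (WhitenedGram.lambdaMin
    (WhitenedGram.empGram (fun i => X n i ω) (WhitenedGram.whiten P (h n))) - 1) 0,
    fun n => ((hmeas n).sub_const 1).min measurable_const, ?_, fun n ω => ?_⟩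
  · have hlim := ENNReal.Tendsto.sub (tendsto_const_nhds (x := (1 : ℝ≥0∞)))
      (htail (1 / 2) (by norm_num) (by norm_num)) (Or.inl ENNReal.one_ne_top)
    rw [tsub_zero] at hlim
    refine tendsto_of_tendsto_of_tendsto_of_le_of_le hlim tendsto_const_nhds (fun n => ?_)
      fun n => prob_le_one
    have hms : MeasurableSet {ω | WhitenedGram.lambdaMin (WhitenedGram.empGram (fun i => X n i ω)
        (WhitenedGram.whiten P (h n))) < 1 - 1 / 2} := measurableSet_lt (hmeas n) measurable_const
    rw [← prob_compl_eq_one_sub hms]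
    refine measure_mono fun ω hω => ?_
    refine WhitenedGram.isUnit_of_lambdaMin_pos (hherm n ω) ?_
    have : 1 - 1 / 2 ≤ WhitenedGram.lambdaMin (WhitenedGram.empGram (fun i => X n i ω)
        (WhitenedGram.whiten P (h n))) := not_lt.1 hω
    linarith
  · rw [tendstoInMeasure_iff_norm]
    intro ε hε
    -- Halving `ε` turns `λ_min ≤ 1 - ε` into a strict inequality; the cap at `1` meets the range of
    -- `htail`.
    refine tendsto_of_tendsto_of_tendsto_of_le_of_le tendsto_const_nhds
      (htail (min (ε / 2) 1) (by positivity) (min_le_right _ _)) (fun _ => zero_le)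
      fun n => measure_mono fun ω hω => ?_
    simp only [Set.mem_ofPred_eq, sub_zero, Real.norm_eq_abs] at hω ⊢
    rw [abs_of_nonpos (min_le_right _ _), ← neg_le_neg_iff, neg_neg, min_le_iff] at hω
    have := min_le_left (ε / 2) 1
    rcases hω with hω | hω <;> linarith
  · linarith [min_le_left (WhitenedGram.lambdaMin (WhitenedGram.empGram (fun i => X n i ω)
      (WhitenedGram.whiten P (h n))) - 1) 0]
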